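/- **Setting.** Fix numbers $N$ of servers, $F$ of files and $M\ge 1$. A *QPIR protocol* for files $W_1,\dots,W_F\in\{0,\dots,M-1\}$ consists of: finite-dimensional quantum systems $\mathcal H^0_t$ (held by server $t$) and $\mathcal H_t$ (sent by server $t$ to the user) for $t=1,\dots,N$; a state $\rho_{\mathrm{prev}}$ on $\mathcal H^0_1\otimes\cdots\otimes\mathcal H^0_N$ shared by the servers; finite query sets $\mathcal Q_1,\dots,\mathcal Q_N$; a random variable $R$ of the user, independent of the files and of the index $K$ of the wanted file, and a user encoder giving the queries $Q=(Q_1,\dots,Q_N)=\mathrm{Enc}(K,R)\in\mathcal Q_1\times\cdots\times\mathcal Q_N$; server encoders giving for each $t$ a trace-preserving completely positive map $\Lambda_t$ from $\mathcal H^0_t$ to $\mathcal H_t$ that depends only on $Q_t$ and on $W=(W_1,\dots,W_F)$; and a decoder giving, for each value of $(K,Q)$, a POVM $\{Y_0,\dots,Y_{M-1},Y_{\mathrm{fail}}\}$ on $\mathcal H=\mathcal H_1\otimes\cdots\otimes\mathcal H_N$. The user receives $\rho^{W,Q}=(\Lambda_1\otimes\cdots\otimes\Lambda_N)(\rho_{\mathrm{prev}})$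 and measures the POVM. The files $W_1,\dots,W_F$ and the index $K\in\{1,\dots,F\}$ are independent and uniformly distributed. With $I$ the (quantum or classical) mutual information, put $$\alpha=\mathbb E_{W,K,Q}\bigl(1-\operatorname{Tr}\rho^{W,Q}Y_{W_K}\bigr),\qquad \beta=\max_{i\ne k} I(W_i;\mathcal H\mid K=k)_{\rho^{W,Q}},\qquad \gamma=\max_{t} I(K;Q'_t),$$ where $Q'_t$ is the collection of the queries to all servers other than $t$. The protocol is an *$(N-1)$-private QSPIR protocol* if $\alpha=\beta=\gamma=0$. Its upload cost is $U=\prod_t|\mathcal Q_t|$ (that is, $\log_2U$ bits), its download cost is $D=\dim\mathcal H$, and its rate is $\log M/\log D$. **Theorem.** For all integers $N\ge 2$, $F\ge 2$ and $\ell\ge 1$ there is an $(N-1)$-private QSPIR protocol for $N$ servers and $F$ files of $2\ell$ bits each ($M=2^{2\ell}$) with zero error $\alpha=0$, zero server leakage $\beta=0$, zero user leakage $\gamma=0$, rate $\lceil N/2\rceil^{-1}$, and upload cost of $NF$ bits ($U=2^{NF}$, for every $\ell$). Moreover the server leakage is zero also against a user who keeps the queries: $\max_{i\ne k}I(W_i;\mathcal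 H\mid Q,K=k)_{\rho^{W,Q}}=0$. -/

import Mathlib

open scoped Kronecker ComplexOrder

noncomputable section

namespace QPIR

/-! Finite-dimensional quantum systems. A system `ℂ^a` is given by the finite type `a` that indexes
an orthonormal basis, operators on it are matrices indexed by `a`, and the composite of a family of
systems `A t` is indexed by the dependent functions `∀ t, A t`. -/

/-- Density matrices: positive semidefinite matrices of trace one. -/
def IsState {a : Type} [Fintype a] (ρ : Matrix a a ℂ) : Prop :=
  ρ.PosSemidef ∧ ρ.trace = 1

/-- `Λ ⊗ ι`, where `ι` is the identity map on the system `ℂ^d`. -/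
def ampliate {a b : Type} (Λ : Matrix a a ℂ →ₗ[ℂ] Matrix b b ℂ) (d : ℕ)
    (ρ : Matrix (a × Fin d) (a × Fin d) ℂ) : Matrix (b × Fin d) (b × Fin d) ℂ :=
  Matrix.of fun i j => Λ (Matrix.of fun x y => ρ (x, i.2) (y, j.2)) i.1 j.1

/-- Quantum operations: trace-preserving and completely positive linear maps. -/
structure Channel (a b : Type) [Fintype a] [Fintype b] where
  map : Matrix a a ℂ →ₗ[ℂ] Matrix b b ℂ
  trace_preserving : ∀ ρ : Matrix a a ℂ, (map ρ).trace = ρ.trace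
  completely_positive : ∀ (d : ℕ) (ρ : Matrix (a × Fin d) (a × Fin d) ℂ),
    ρ.PosSemidef → (ampliate map d ρ).PosSemidef

/-- `Λ_1 ⊗ ⋯ ⊗ Λ_N`, acting on the composite system: the linear map that sends the tensor product of
the matrix units `|x_t⟩⟨y_t|` to the tensor product of the matrices `Λ_t (|x_t⟩⟨y_t|)`. -/
def tensorMap {N : ℕ} {A B : Fin N → Type} [∀ t, Fintype (A t)] [∀ t, DecidableEq (A t)]
    (Λ : ∀ t, Matrix (A t) (A t) ℂ →ₗ[ℂ] Matrix (B t) (B t) ℂ)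
    (ρ : Matrix (∀ t, A t) (∀ t, A t) ℂ) : Matrix (∀ t, B t) (∀ t, B t) ℂ :=
  Matrix.of fun i j =>
    ∑ x, ∑ y, ρ x y * ∏ t, Λ t (Matrix.single (x t) (y t) 1) (i t) (j t)

/-- Positive-operator valued measures on `ℂ^a` with outcomes in the finite set `ι`. -/
structure POVM (ι a : Type) [Fintype ι] [Fintype a] [DecidableEq a] where
  op : ι → Matrix a a ℂ
  posSemidef : ∀ i, (op i).PosSemidef
  sum_eq_one : ∑ i, op i = 1

/-- The reduced state on the first of two systems. -/
def reduceFst {a b : Type} [Fintype b] (ρ : Matrix (a × b) (a × b) ℂ) : Matrix a a ℂ :=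
  Matrix.of fun i j => ∑ k, ρ (i, k) (j, k)

/-- The reduced state on the second of two systems. -/
def reduceSnd {a b : Type} [Fintype a] (ρ : Matrix (a × b) (a × b) ℂ) : Matrix b b ℂ :=
  Matrix.of fun i j => ∑ k, ρ (k, i) (k, j)

open Classical in
/-- The von Neumann entropy `-Tr ρ log ρ` (the value for non-Hermitian matrices is irrelevant). -/
def entropy {a : Type} [Fintype a] [DecidableEq a] (ρ : Matrix a a ℂ) : ℝ :=
  if h : ρ.IsHermitian then ∑ i, Real.negMulLog (h.eigenvalues i) else 0

/-- The quantum mutual information of the two subsystems of a bipartite system. -/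
def quantumMutualInfo {a b : Type} [Fintype a] [DecidableEq a] [Fintype b] [DecidableEq b]
    (ρ : Matrix (a × b) (a × b) ℂ) : ℝ :=
  entropy (reduceFst ρ) + entropy (reduceSnd ρ) - entropy ρ

/-- The classical mutual information of the two coordinates of a joint distribution `p`. -/
def mutualInfo {α β : Type} [Fintype α] [Fintype β] (p : α → β → ℝ) : ℝ :=
  ∑ x, Real.negMulLog (∑ y, p x y) + ∑ y, Real.negMulLog (∑ x, p x y)
    - ∑ x, ∑ y, Real.negMulLog (p x y)

/-- A protocol of quantum private information retrieval with `N` servers and `F` files, each file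
being an element of `{0, …, M - 1}`; a file set is a function `Fin F → Fin M`. -/
structure QPIRProtocol (N F M : ℕ) where
  /-- the system of the `t`-th server before the protocol -/
  Prior : Fin N → Type
  /-- the system sent by the `t`-th server to the user -/
  Sys : Fin N → Type
  /-- the possible queries to the `t`-th server -/
  Query : Fin N → Type
  /-- the values of the randomness of the user -/
  Rand : Type
  [fintypePrior : ∀ t, Fintype (Prior t)]
  [decidableEqPrior : ∀ t, DecidableEq (Prior t)]
  [fintypeSys : ∀ t, Fintype (Sys t)]
  [decidableEqSys : ∀ t, DecidableEq (Sys t)]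
  [fintypeQuery : ∀ t, Fintype (Query t)]
  /-- the state shared by the servers -/
  priorState : Matrix (∀ t, Prior t) (∀ t, Prior t) ℂ
  priorState_isState : IsState priorState
  /-- the law of the randomness of the user, which is independent of the files and of the index -/
  randLaw : PMF Rand
  /-- the user encoder, which makes the queries from the index and the randomness -/
  encUser : Fin F → Rand → ∀ t, Query t
  /-- the server encoders; a server sees only its own query and the files -/
  encServ : ∀ t, Query t → (Fin F → Fin M) → Channel (Prior t) (Sys t)
  /-- the decoder; the outcome `some w` means that `w` is retrieved, `none` is decoding failure -/
  dec : Fin F → (∀ t, Query t) → POVM (Option (Fin M)) (∀ t, Sys t)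

attribute [instance] QPIRProtocol.fintypePrior QPIRProtocol.decidableEqPrior
  QPIRProtocol.fintypeSys QPIRProtocol.decidableEqSys QPIRProtocol.fintypeQuery

namespace QPIRProtocol

variable {N F M : ℕ} (Ψ : QPIRProtocol N F M)

/-- The state `ρ^{W,Q}` of the downloaded systems for the files `W = w` and the queries `Q = q`. -/
def finalState (w : Fin F → Fin M) (q : ∀ t, Ψ.Query t) :
    Matrix (∀ t, Ψ.Sys t) (∀ t, Ψ.Sys t) ℂ :=
  tensorMap (fun t => (Ψ.encServ t (q t) w).map) Ψ.priorState

/-- The law of the queries to all servers when the index is `K = k`. -/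
def queryLaw (k : Fin F) : PMF (∀ t, Ψ.Query t) := Ψ.randLaw.map (Ψ.encUser k)

/-- The law of the queries to all servers other than `t` when the index is `K = k`. -/
def otherQueryLaw (t : Fin N) (k : Fin F) : PMF (∀ s : {s : Fin N // s ≠ t}, Ψ.Query s) :=
  (Ψ.queryLaw k).map fun q s => q s

/-- The upload cost `∏_t |𝒬_t|`. -/
def upload : ℕ := ∏ t, Fintype.card (Ψ.Query t)

/-- The download cost, the dimension of the tensor product of the downloaded systems. -/
def download : ℕ := ∏ t, Fintype.card (Ψ.Sys t)

/-- The rate `log M / log D`, where `D` is the download cost. -/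
def rate : ℝ := Real.log M / Real.log Ψ.download

/-- The error measure: the average error probability, the files `W` and the index `K` being
independent and uniformly distributed. -/
def errorProb : ℝ :=
  ∑ w : Fin F → Fin M, ∑ k : Fin F, ∑ q : ∀ t, Ψ.Query t,
    ((M : ℝ) ^ F)⁻¹ * (F : ℝ)⁻¹ * (Ψ.queryLaw k q).toReal *
      (1 - (Ψ.finalState w q * (Ψ.dec k q).op (some (w k))).trace.re)

/-- The joint state of the file `W_i` and the downloaded systems when the queries are `Q = q`, the
files being independent and uniformly distributed:
`M^{-F} ∑_w |w_i⟩⟨w_i| ⊗ ρ^{w,q}`. -/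
def fileStateOfQuery (i : Fin F) (q : ∀ t, Ψ.Query t) :
    Matrix (Fin M × (∀ t, Ψ.Sys t)) (Fin M × (∀ t, Ψ.Sys t)) ℂ :=
  ∑ w : Fin F → Fin M,
    ((M : ℂ) ^ F)⁻¹ • (Matrix.single (w i) (w i) (1 : ℂ) ⊗ₖ Ψ.finalState w q)

/-- The joint state of the file `W_i` and the downloaded systems when the index is `K = k`. -/
def fileState (i k : Fin F) :
    Matrix (Fin M × (∀ t, Ψ.Sys t)) (Fin M × (∀ t, Ψ.Sys t)) ℂ :=
  ∑ q : ∀ t, Ψ.Query t, ((Ψ.queryLaw k q).toReal : ℂ) • Ψ.fileStateOfQuery i q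

/-- The server secrecy measure: the maximum of `I(W_i; ℋ | K = k)` over the pairs `i ≠ k`. -/
def serverLeakage : ℝ :=
  ⨆ p : {p : Fin F × Fin F // p.1 ≠ p.2}, quantumMutualInfo (Ψ.fileState p.1.1 p.1.2)

/-- The server secrecy measure against a user who keeps the queries: the maximum of
`I(W_i; ℋ | Q, K = k)` over the pairs `i ≠ k`. As `W_i` is independent of `(Q, K)`, this equals the
maximum of `I(W_i; ℋ Q | K = k)`. -/
def serverLeakageGivenQueries : ℝ :=
  ⨆ p : {p : Fin F × Fin F // p.1 ≠ p.2}, ∑ q : ∀ t, Ψ.Query t,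
    (Ψ.queryLaw p.1.2 q).toReal * quantumMutualInfo (Ψ.fileStateOfQuery p.1.1 q)

/-- The user secrecy measure: the maximum over `t` of the mutual information between the uniformly
distributed index `K` and the queries to all servers other than `t`. -/
def userLeakage : ℝ :=
  ⨆ t : Fin N, mutualInfo fun k q' => (F : ℝ)⁻¹ * (Ψ.otherQueryLaw t k q').toReal

/-- `(N-1)`-private symmetric protocols: all three measures are zero. -/
def IsPrivateSymmetric : Prop :=
  Ψ.errorProb = 0 ∧ Ψ.serverLeakage = 0 ∧ Ψ.userLeakage = 0

end QPIRProtocol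

end QPIR

end

noncomputable section

namespace QPIR

/-! ### Entropic quantities of product distributions and of maximally mixed states -/

/-! The user shares the indicator vector of `k` additively among the servers: the queries are random
bit strings with sum `e_k`, and any `N - 1` of them have a law independent of `k`
(`otherQueryLaw_stabilizerProtocol`). Each server adds up the files its query selects; by linearity
these answers sum to the wanted file (`sum_serverAnswer`).

The quantum part sums the answers without revealing them. On an even number `n` of registers the
operators `X(c)^{⊗n}` and `Z(c)^{⊗n}` commute, and their joint eigenspaces are labelled by syndromes
of `2ℓ` bits. The servers share the maximally mixed state of syndrome `0`. A Pauli operator `X(a)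
Z(b)` on one register moves the syndrome by `(a, b)`, so the received state is the maximally mixed
state of the eigenspace with syndrome `W_k` (`tensorMap_syndromeState`). Measuring the syndrome
returns `W_k` with certainty. The state depends on no other file, even given the queries, and its
average over `W_k` is maximally mixed (`sum_syndromeState`), so it is in a product state with `W_i`
for `i ≠ k`.

One register per server, plus one more if `N` is odd, gives `n = 2⌈N/2⌉` and dimension `2^{ℓn}`,
against `2ℓ` retrieved bits. -/

theorem entropy_smul_one {a : Type} [Fintype a] [DecidableEq a] (c : ℝ) :
    entropy ((c : ℂ) • (1 : Matrix a a ℂ)) = Fintype.card a * Real.negMulLog c := by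
  have h : ((c : ℂ) • (1 : Matrix a a ℂ)).IsHermitian := by
    simp [Matrix.IsHermitian, Matrix.conjTranspose_smul]
  have hev : ∀ i, h.eigenvalues i = c := by
    intro i
    have h1 := h.mulVec_eigenvectorBasis i
    rw [Matrix.smul_mulVec, Matrix.one_mulVec] at h1
    have h2 : ((c : ℂ) - h.eigenvalues i) • (h.eigenvectorBasis i).ofLp = 0 := by
      rw [sub_smul, h1]
      ext x; simp
    rcases smul_eq_zero.1 h2 with h3 | h3
    · exact_mod_cast (sub_eq_zero.1 h3).symm
    · exact absurd (by ext x; simpa using congrFun h3 x) (h.eigenvectorBasis.orthonormal.ne_zero i)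
  rw [entropy, dif_pos h]
  simp [hev]

theorem card_mul_negMulLog_inv {n : ℕ} (hn : n ≠ 0) :
    n * Real.negMulLog ((n : ℝ)⁻¹) = Real.log n := by
  have : (n : ℝ) ≠ 0 := by exact_mod_cast hn
  rw [Real.negMulLog, Real.log_inv]
  field_simp

/-- Both marginals are maximally mixed, so the value is `log |a| + log |b| - log (|a| |b|)`. -/
theorem quantumMutualInfo_smul_one {a b : Type} [Fintype a] [DecidableEq a] [Fintype b]
    [DecidableEq b] [Nonempty a] [Nonempty b] :
    quantumMutualInfo ((Fintype.card (a × b) : ℂ)⁻¹ • (1 : Matrix (a × b) (a × b) ℂ)) = 0 := by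
  have h0 : (Fintype.card (a × b) : ℂ)⁻¹ = (((Fintype.card (a × b) : ℝ)⁻¹ : ℝ) : ℂ) := by
    push_cast; rfl
  have h1 : reduceFst ((((Fintype.card (a × b) : ℝ)⁻¹ : ℝ) : ℂ) • (1 : Matrix (a × b) (a × b) ℂ))
      = (((Fintype.card a : ℝ)⁻¹ : ℝ) : ℂ) • 1 := by
    ext i j
    by_cases hij : i = j
    · subst hij
      simp [reduceFst, Fintype.card_prod]
    · simp [reduceFst, Matrix.one_apply, hij]
  have h2 : reduceSnd ((((Fintype.card (a × b) : ℝ)⁻¹ : ℝ) : ℂ) • (1 : Matrix (a × b) (a × b) ℂ))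
      = (((Fintype.card b : ℝ)⁻¹ : ℝ) : ℂ) • 1 := by
    ext i j
    by_cases hij : i = j
    · subst hij
      simp [reduceSnd, Fintype.card_prod]
      field_simp
    · simp [reduceSnd, Matrix.one_apply, hij]
  rw [h0, quantumMutualInfo, h1, h2, entropy_smul_one, entropy_smul_one, entropy_smul_one,
    card_mul_negMulLog_inv Fintype.card_ne_zero, card_mul_negMulLog_inv Fintype.card_ne_zero,
    card_mul_negMulLog_inv Fintype.card_ne_zero, Fintype.card_prod, Nat.cast_mul, Real.log_mul]
  · ring
  · simp
  · simp

theorem mutualInfo_mul {α β : Type} [Fintype α] [Fintype β] (p : α → ℝ) (r : β → ℝ)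
    (hp : ∑ x, p x = 1) (hr : ∑ y, r y = 1) : mutualInfo (fun x y => p x * r y) = 0 := by
  simp only [mutualInfo, ← Finset.mul_sum, ← Finset.sum_mul, hp, hr, mul_one, one_mul,
    Real.negMulLog_mul, Finset.sum_add_distrib]
  ring

theorem sum_toReal_pmf {α : Type*} [Fintype α] (p : PMF α) : ∑ x, (p x).toReal = 1 := by
  rw [← ENNReal.toReal_sum fun x _ => p.apply_ne_top x, ← tsum_fintype (L := .unconditional α), p.tsum_coe]
  rfl

theorem map_equiv_uniformOfFintype {α : Type*} [Fintype α] [Nonempty α] (e : α ≃ α) :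
    (PMF.uniformOfFintype α).map e = PMF.uniformOfFintype α := by
  ext x
  rw [PMF.map_apply, tsum_eq_single (e.symm x)]
  · simp
  · intro y hy
    rw [if_neg]
    rintro rfl
    simp at hy

/-! ### Characters of bit strings -/

/-- Bit strings of length `ℓ`. -/
abbrev Bits (ℓ : ℕ) : Type := Fin ℓ → ZMod 2

theorem bits_add_self {ℓ : ℕ} (a : Bits ℓ) : a + a = 0 := by
  ext i; exact CharTwo.add_self_eq_zero _

/-- The nontrivial character of `ℤ/2`. -/
def bitSign (u : ZMod 2) : ℂ := if u = 0 then 1 else -1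

theorem bitSign_add : ∀ u v : ZMod 2, bitSign (u + v) = bitSign u * bitSign v := by
  -- Over `ℤ` the four cases are decidable; the result is then cast to `ℂ`.
  have h : ∀ u v : ZMod 2, (if u + v = 0 then (1 : ℤ) else -1) =
      (if u = 0 then 1 else -1) * (if v = 0 then 1 else -1) := by decide
  intro u v
  simpa [bitSign] using congrArg (Int.cast : ℤ → ℂ) (h u v)

theorem bitSign_mul_self (u : ZMod 2) : bitSign u * bitSign u = 1 := by
  unfold bitSign; split_ifs <;> simp

theorem star_bitSign (u : ZMod 2) : star (bitSign u) = bitSign u := by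
  unfold bitSign; split_ifs <;> simp

/-- The pairing `(-1)^(b · c)` of bit strings. -/
def pairing {ℓ : ℕ} (b c : Bits ℓ) : ℂ := bitSign (b ⬝ᵥ c)

section pairing
variable {ℓ : ℕ}

theorem pairing_add_left (a b c : Bits ℓ) : pairing (a + b) c = pairing a c * pairing b c := by
  rw [pairing, add_dotProduct, bitSign_add]; rfl

theorem pairing_add_right (a b c : Bits ℓ) : pairing a (b + c) = pairing a b * pairing a c := by
  rw [pairing, dotProduct_add, bitSign_add]; rfl

@[simp] theorem pairing_zero_left (c : Bits ℓ) : pairing 0 c = 1 := by simp [pairing, bitSign]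

@[simp] theorem pairing_zero_right (c : Bits ℓ) : pairing c 0 = 1 := by simp [pairing, bitSign]

theorem pairing_mul_self (b c : Bits ℓ) : pairing b c * pairing b c = 1 := bitSign_mul_self _

theorem star_pairing (b c : Bits ℓ) : star (pairing b c) = pairing b c := star_bitSign _

theorem pairing_sum_left {ι : Type*} (s : Finset ι) (f : ι → Bits ℓ) (c : Bits ℓ) :
    pairing (∑ i ∈ s, f i) c = ∏ i ∈ s, pairing (f i) c := by
  classical
  induction s using Finset.induction_on with
  | empty => simp
  | insert i s hi ih => rw [Finset.sum_insert hi, Finset.prod_insert hi, pairing_add_left, ih]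

/-- Orthogonality of characters: if `c i ≠ 0`, translating `b` by the `i`-th unit vector changes the
sign of the sum. -/
theorem sum_pairing (c : Bits ℓ) : ∑ b, pairing b c = if c = 0 then (2 : ℂ) ^ ℓ else 0 := by
  split_ifs with hc
  · simp [hc]
  · obtain ⟨i, hi⟩ := Function.ne_iff.1 hc
    have h1 : pairing (Pi.single i 1) c = -1 := by
      simp only [pairing, single_dotProduct, one_mul, bitSign]
      exact if_neg hi
    have h2 : ∑ b, pairing b c = ∑ b, pairing (Pi.single i 1 + b) c :=
      (Equiv.sum_comp (Equiv.addLeft (Pi.single i 1)) fun b => pairing b c).symm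
    simp only [pairing_add_left, ← Finset.mul_sum, h1] at h2
    linear_combination h2 / 2

end pairing

/-! ### The stabilizer projections -/

/-- Basis labels of `m + 1` registers of `ℓ` qubits. -/
abbrev Site (ℓ m : ℕ) : Type := Bits ℓ × (Fin m → Bits ℓ)

section stabilizer
variable {ℓ N : ℕ} {m : Fin N → ℕ}

/-- The sum of the labels of all registers. -/
def labelSum (x : ∀ t, Site ℓ (m t)) : Bits ℓ := ∑ t, ((x t).1 + ∑ j, (x t).2 j)

/-- The same label in all registers. -/
def diagLabel (m : Fin N → ℕ) (c : Bits ℓ) : ∀ t, Site ℓ (m t) := fun _ => (c, fun _ => c)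

theorem labelSum_add (x y : ∀ t, Site ℓ (m t)) : labelSum (x + y) = labelSum x + labelSum y := by
  simp only [labelSum, ← Finset.sum_add_distrib]
  refine Finset.sum_congr rfl fun t _ => ?_
  simp only [Pi.add_apply, Prod.fst_add, Prod.snd_add, Finset.sum_add_distrib]
  abel

/-- The label `c` is added once per register, an even number of times. This is the commutation of
`X(c)^{⊗n}` with the `Z(d)^{⊗n}`. -/
theorem labelSum_diagLabel (hm : Even (∑ t, (m t + 1))) (c : Bits ℓ) :
    labelSum (diagLabel m c) = 0 := by
  have : labelSum (diagLabel m c) = (∑ t, (m t + 1)) • c := by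
    simp only [labelSum, diagLabel, Finset.sum_smul, add_smul]
    simp [add_comm]
  obtain ⟨r, hr⟩ := hm
  rw [this, hr, add_smul, bits_add_self]

theorem diagLabel_add (a b : Bits ℓ) : diagLabel m (a + b) = diagLabel m a + diagLabel m b := rfl

theorem diagLabel_eq_zero [NeZero N] {c : Bits ℓ} : diagLabel m c = 0 ↔ c = 0 :=
  ⟨fun h => congrArg Prod.fst (congrFun h 0), fun h => by subst h; rfl⟩

/-- The projection to the joint eigenspace of the operators `X(c)^{⊗n}` and `Z(c)^{⊗n}` with
syndrome `v`. -/
def syndromeProj (m : Fin N → ℕ) (v : Bits ℓ × Bits ℓ) :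
    Matrix (∀ t, Site ℓ (m t)) (∀ t, Site ℓ (m t)) ℂ :=
  Matrix.of fun x y => if labelSum x = v.1 then
    ∑ c, if y = x + diagLabel m c then ((2 : ℂ) ^ ℓ)⁻¹ * pairing v.2 c else 0 else 0

theorem eq_add_diagLabel_comm {x y : ∀ t, Site ℓ (m t)} {c : Bits ℓ} :
    y = x + diagLabel m c ↔ x = y + diagLabel m c := by
  have h : diagLabel m c + diagLabel m c = 0 := by
    rw [← diagLabel_add, bits_add_self]; rfl
  constructor <;> rintro rfl <;> rw [add_assoc, h, add_zero]

theorem labelSum_eq_of_diag (hm : Even (∑ t, (m t + 1))) {x y : ∀ t, Site ℓ (m t)} {c : Bits ℓ}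
    (h : y = x + diagLabel m c) : labelSum y = labelSum x := by
  rw [h, labelSum_add, labelSum_diagLabel hm, add_zero]

theorem isHermitian_syndromeProj (hm : Even (∑ t, (m t + 1))) (v : Bits ℓ × Bits ℓ) :
    (syndromeProj m v).IsHermitian := by
  -- With the syndrome condition inside the sum, the matrix and its adjoint agree term by term.
  have key : ∀ x y, syndromeProj m v x y = ∑ c, if y = x + diagLabel m c then
      if labelSum x = v.1 then ((2 : ℂ) ^ ℓ)⁻¹ * pairing v.2 c else 0 else 0 := by
    intro x y
    simp only [syndromeProj, Matrix.of_apply]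
    split_ifs <;> simp
  ext x y
  rw [Matrix.conjTranspose_apply, key, key, star_sum]
  refine Finset.sum_congr rfl fun c _ => ?_
  by_cases h : y = x + diagLabel m c
  · rw [if_pos h, if_pos (eq_add_diagLabel_comm.1 h), labelSum_eq_of_diag hm h]
    split_ifs
    · rw [star_mul', star_pairing]; simp
    · simp
  · rw [if_neg h, if_neg (mt eq_add_diagLabel_comm.2 h), star_zero]

/-- Averaging twice over a group against a character is averaging once: each of the `2 ^ ℓ`
translates contributes `2 ^ (-ℓ)` times the same entry. -/
theorem syndromeProj_mul_self (hm : Even (∑ t, (m t + 1))) (v : Bits ℓ × Bits ℓ) :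
    syndromeProj m v * syndromeProj m v = syndromeProj m v := by
  ext x z
  rw [Matrix.mul_apply]
  by_cases hx : labelSum x = v.1
  · have h1 : ∀ y, syndromeProj m v x y * syndromeProj m v y z =
        ∑ c, if y = x + diagLabel m c then
          ((2 : ℂ) ^ ℓ)⁻¹ * pairing v.2 c * syndromeProj m v y z else 0 := by
      intro y
      rw [syndromeProj, Matrix.of_apply, if_pos hx, Finset.sum_mul]
      simp only [ite_mul, zero_mul]
    simp only [h1]
    rw [Finset.sum_comm]
    simp only [Finset.sum_ite_eq', Finset.mem_univ, if_true]
    have h2 : ∀ c, ((2 : ℂ) ^ ℓ)⁻¹ * pairing v.2 c * syndromeProj m v (x + diagLabel m c) z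
        = ((2 : ℂ) ^ ℓ)⁻¹ * syndromeProj m v x z := by
      intro c
      simp only [syndromeProj, Matrix.of_apply]
      rw [labelSum_eq_of_diag hm rfl, if_pos hx, if_pos hx, mul_assoc, Finset.mul_sum]
      congr 1
      rw [← Equiv.sum_comp (Equiv.addLeft c)]
      refine Finset.sum_congr rfl fun d _ => ?_
      have h3 : x + diagLabel m c + diagLabel m (c + d) = x + diagLabel m d := by
        rw [add_assoc, ← diagLabel_add, ← add_assoc, bits_add_self, zero_add]
      simp only [Equiv.coe_addLeft, h3, pairing_add_right, mul_ite, mul_zero]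
      congr 1
      linear_combination ((2 : ℂ) ^ ℓ)⁻¹ * pairing v.2 d * pairing_mul_self v.2 c
    simp only [h2]
    simp
  · have h1 : ∀ y, syndromeProj m v x y = 0 := fun y => by
      rw [syndromeProj, Matrix.of_apply, if_neg hx]
    simp [h1]

theorem posSemidef_syndromeProj (hm : Even (∑ t, (m t + 1))) (v : Bits ℓ × Bits ℓ) :
    (syndromeProj m v).PosSemidef := by
  have h := Matrix.posSemidef_conjTranspose_mul_self (syndromeProj m v)
  rwa [(isHermitian_syndromeProj hm v).eq, syndromeProj_mul_self hm] at h

/-- Only `v.1 = labelSum x` contributes to row `x`; summing over `v.2` then removes all `c ≠ 0` by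
`sum_pairing`. -/
theorem sum_syndromeProj : ∑ v, syndromeProj (ℓ := ℓ) m v = 1 := by
  ext x y
  rw [Matrix.sum_apply, Fintype.sum_prod_type, Finset.sum_eq_single (labelSum x)]
  · simp only [syndromeProj, Matrix.of_apply, if_true]
    rw [Finset.sum_comm]
    have h : ∀ c : Bits ℓ, (∑ b : Bits ℓ, if y = x + diagLabel m c then
        ((2 : ℂ) ^ ℓ)⁻¹ * pairing b c else 0) =
        if c = 0 then (1 : Matrix (∀ t, Site ℓ (m t)) (∀ t, Site ℓ (m t)) ℂ) x y else 0 := by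
      intro c
      by_cases hy : y = x + diagLabel m c
      · simp only [if_pos hy, ← Finset.mul_sum, sum_pairing]
        split_ifs with hc
        · have : x = y := by rw [hy, hc]; ext <;> simp [diagLabel]
          rw [this, Matrix.one_apply_eq]
          simp
        · simp
      · simp only [if_neg hy, Finset.sum_const_zero]
        split_ifs with hc
        · rw [Matrix.one_apply_ne]
          rintro rfl
          apply hy
          rw [hc]; ext <;> simp [diagLabel]
        · rfl
    simp only [h]
    simp
  · intro a _ ha
    simp [syndromeProj, ha.symm]
  · simp

/-- On the diagonal only `c = 0` survives, so the trace counts labels with sum `v.1`, and a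
translation of labels makes this count independent of `v`. -/
theorem trace_syndromeProj [NeZero N] (v : Bits ℓ × Bits ℓ) :
    (syndromeProj m v).trace = (syndromeProj (ℓ := ℓ) m 0).trace := by
  have h : ∀ v : Bits ℓ × Bits ℓ, (syndromeProj m v).trace =
      ∑ x : ∀ t, Site ℓ (m t), if labelSum x = v.1 then ((2 : ℂ) ^ ℓ)⁻¹ else 0 := by
    intro v
    refine Finset.sum_congr rfl fun x _ => ?_
    simp [syndromeProj, diagLabel_eq_zero]
  let s : ∀ t, Site ℓ (m t) := Pi.single 0 (v.1, 0)
  have hs : labelSum s = v.1 := by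
    rw [labelSum, Finset.sum_eq_single 0]
    · simp [s]
    · intro t _ ht
      simp [s, Pi.single_eq_of_ne ht]
    · simp
  rw [h, h, ← Equiv.sum_comp (Equiv.addRight s)]
  simp [labelSum_add, hs]

theorem trace_syndromeProj_zero_ne [NeZero N] : (syndromeProj (ℓ := ℓ) m 0).trace ≠ 0 := by
  intro h
  have h1 := congrArg Matrix.trace (sum_syndromeProj (ℓ := ℓ) (m := m))
  simp only [Matrix.trace_sum, trace_syndromeProj, h, Finset.sum_const_zero, Matrix.trace_one] at h1
  exact Fintype.card_ne_zero (α := ∀ t, Site ℓ (m t)) (by exact_mod_cast h1.symm)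

/-- The maximally mixed state of the eigenspace with syndrome `v`. -/
def syndromeState (m : Fin N → ℕ) (v : Bits ℓ × Bits ℓ) :
    Matrix (∀ t, Site ℓ (m t)) (∀ t, Site ℓ (m t)) ℂ :=
  (syndromeProj (ℓ := ℓ) m 0).trace⁻¹ • syndromeProj m v

theorem isState_syndromeState [NeZero N] (hm : Even (∑ t, (m t + 1))) (v : Bits ℓ × Bits ℓ) :
    IsState (syndromeState m v) := by
  constructor
  · exact (posSemidef_syndromeProj hm v).smul
      (inv_nonneg_of_nonneg (posSemidef_syndromeProj hm 0).trace_nonneg)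
  · rw [syndromeState, Matrix.trace_smul, trace_syndromeProj v, smul_eq_mul,
      inv_mul_cancel₀ trace_syndromeProj_zero_ne]

theorem trace_syndromeState_mul [NeZero N] (hm : Even (∑ t, (m t + 1))) (v : Bits ℓ × Bits ℓ) :
    (syndromeState m v * syndromeProj m v).trace = 1 := by
  rw [syndromeState, Matrix.smul_mul, syndromeProj_mul_self hm]
  exact (isState_syndromeState hm v).2

theorem sum_syndromeState [NeZero N] : ∑ v, syndromeState (ℓ := ℓ) m v =
    ((Fintype.card (Bits ℓ × Bits ℓ) : ℂ) / Fintype.card (∀ t, Site ℓ (m t))) • 1 := by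
  have h1 := congrArg Matrix.trace (sum_syndromeProj (ℓ := ℓ) (m := m))
  simp only [Matrix.trace_sum, trace_syndromeProj, Finset.sum_const, Matrix.trace_one,
    nsmul_eq_mul, Finset.card_univ] at h1
  simp only [syndromeState, ← Finset.smul_sum, sum_syndromeProj]
  rw [← h1]
  congr 1
  have h2 := trace_syndromeProj_zero_ne (ℓ := ℓ) (m := m)
  have h3 : (Fintype.card (Bits ℓ × Bits ℓ) : ℂ) ≠ 0 := by
    exact_mod_cast Fintype.card_ne_zero
  field_simp

end stabilizer

/-! ### The Pauli channels -/

/-- The channel of the unitary `X(a) Z(b)` on the first register of a site. -/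
def pauliChannel (ℓ m : ℕ) (v : Bits ℓ × Bits ℓ) : Channel (Site ℓ m) (Site ℓ m) where
  map :=
    { toFun := fun ρ => Matrix.of fun x y =>
        pairing v.2 x.1 * ρ (x + (v.1, 0)) (y + (v.1, 0)) * pairing v.2 y.1
      map_add' := fun ρ σ => by ext; simp [mul_add, add_mul]
      map_smul' := fun c ρ => by ext; simp; ring }
  trace_preserving := fun ρ => by
    simp only [Matrix.trace, Matrix.diag, LinearMap.coe_mk, AddHom.coe_mk, Matrix.of_apply]
    rw [← Equiv.sum_comp (Equiv.addRight ((v.1, 0) : Site ℓ m)) fun x => ρ x x]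
    refine Finset.sum_congr rfl fun x _ => ?_
    simp only [Equiv.coe_addRight]
    linear_combination ρ (x + (v.1, 0)) (x + (v.1, 0)) * pairing_mul_self v.2 x.1
  completely_positive := fun d ρ hρ => by
    -- The extended map translates the basis labels and then conjugates by a diagonal matrix; both
    -- preserve positivity.
    have h := (hρ.submatrix fun x : Site ℓ m × Fin d =>
      (x.1 + ((v.1, 0) : Site ℓ m), x.2)).mul_mul_conjTranspose_same
        (Matrix.diagonal fun x : Site ℓ m × Fin d => pairing v.2 x.1.1)
    convert h using 1
    ext x y
    rw [Matrix.diagonal_conjTranspose, Matrix.mul_diagonal, Matrix.diagonal_mul]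
    simp only [Pi.star_apply, star_pairing]
    rfl

/-- For given `i` and `j` a single pair of matrix units contributes to the double sum. -/
theorem tensorMap_pauliChannel {ℓ N : ℕ} {m : Fin N → ℕ} (v : Fin N → Bits ℓ × Bits ℓ)
    (ρ : Matrix (∀ t, Site ℓ (m t)) (∀ t, Site ℓ (m t)) ℂ) (i j : ∀ t, Site ℓ (m t)) :
    tensorMap (fun t => (pauliChannel ℓ (m t) (v t)).map) ρ i j =
      (∏ t, pairing (v t).2 (i t).1) *
        ρ (i + fun t => ((v t).1, 0)) (j + fun t => ((v t).1, 0)) *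
          ∏ t, pairing (v t).2 (j t).1 := by
  have h : ∀ x y : ∀ t, Site ℓ (m t), ∏ t, (pauliChannel ℓ (m t) (v t)).map
      (Matrix.single (x t) (y t) 1) (i t) (j t) =
      if x = i + (fun t => ((v t).1, 0)) then if y = j + (fun t => ((v t).1, 0)) then
        (∏ t, pairing (v t).2 (i t).1) * ∏ t, pairing (v t).2 (j t).1 else 0 else 0 := by
    intro x y
    have h0 : ∀ t, (pauliChannel ℓ (m t) (v t)).map
        (Matrix.single (x t) (y t) 1) (i t) (j t) =
        pairing (v t).2 (i t).1 * (if x t = i t + ((v t).1, 0) ∧ y t = j t + ((v t).1, 0)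
          then 1 else 0) * pairing (v t).2 (j t).1 := fun t => by
      simp [pauliChannel, Matrix.single_apply]
    simp only [h0, Finset.prod_mul_distrib]
    rw [mul_right_comm, mul_comm]
    by_cases hx : x = i + (fun t => ((v t).1, 0))
    · by_cases hy : y = j + (fun t => ((v t).1, 0))
      · rw [if_pos hx, if_pos hy, Finset.prod_congr rfl fun t _ => if_pos (by simp [hx, hy])]
        simp
      · rw [if_pos hx, if_neg hy]
        obtain ⟨t, ht⟩ := Function.ne_iff.1 hy
        rw [Finset.prod_eq_zero (Finset.mem_univ t)
          (if_neg (fun h : _ ∧ _ => ht h.2))]; ring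
    · rw [if_neg hx]
      obtain ⟨t, ht⟩ := Function.ne_iff.1 hx
      rw [Finset.prod_eq_zero (Finset.mem_univ t)
        (if_neg (fun h : _ ∧ _ => ht h.1))]; ring
  simp only [tensorMap, Matrix.of_apply, h, mul_ite, mul_zero]
  simp only [Finset.sum_ite_irrel, Finset.sum_const_zero, Finset.sum_ite_eq', Finset.mem_univ,
    if_true]
  ring

/-- The `X` parts translate the label sum by the sum of the `(v t).1`; the `Z` parts multiply the
character of `c` by that of the sum of the `(v t).2`. -/
theorem tensorMap_syndromeState {ℓ N : ℕ} {m : Fin N → ℕ} (v : Fin N → Bits ℓ × Bits ℓ) :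
    tensorMap (fun t => (pauliChannel ℓ (m t) (v t)).map) (syndromeState m 0) =
      syndromeState m (∑ t, v t) := by
  ext i j
  have hs : labelSum (m := m) (fun t => ((v t).1, 0)) = (∑ t, v t).1 := by
    simp [labelSum, Prod.fst_sum]
  have hz : ∀ a : Bits ℓ, a + (∑ t, v t).1 = 0 ↔ a = (∑ t, v t).1 := fun a => by
    rw [add_eq_zero_iff_eq_neg, eq_comm, neg_eq_iff_add_eq_zero.2 (bits_add_self _), eq_comm]
  rw [tensorMap_pauliChannel]
  simp only [syndromeState, Matrix.smul_apply, smul_eq_mul]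
  generalize (syndromeProj (ℓ := ℓ) m 0).trace⁻¹ = r
  simp only [syndromeProj, Matrix.of_apply, labelSum_add, hs, Prod.fst_zero, Prod.snd_zero, pairing_zero_left, mul_one, hz]
  split_ifs with h
  · rw [mul_left_comm, mul_assoc, Finset.mul_sum, Finset.sum_mul]
    congr 1
    refine Finset.sum_congr rfl fun c _ => ?_
    simp only [add_right_comm i _ (diagLabel m c), add_left_inj]
    split_ifs with hj
    -- The first labels of `i` and `j` differ by `c` at every server, so the phases of `i` square to
    -- `1` and only those of `c` remain.
    · rw [mul_right_comm, mul_comm, ← Finset.prod_mul_distrib, Prod.snd_sum, pairing_sum_left]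
      congr 1
      refine Finset.prod_congr rfl fun t _ => ?_
      rw [hj, Pi.add_apply, Prod.fst_add, pairing_add_right, ← mul_assoc, pairing_mul_self,
        one_mul]
      rfl
    · simp
  · simp

/-! ### The protocol -/

/-- The number of additional registers of a server: none, except for one at the first server if the
number of servers is odd. -/
def extraSites (N : ℕ) (t : Fin N) : ℕ := if t.val = 0 ∧ Odd N then 1 else 0

theorem sum_extraSites_add_one (N : ℕ) [NeZero N] :
    ∑ t, (extraSites N t + 1) = 2 * ⌈(N : ℚ) / 2⌉₊ := by
  have h0 : ∑ t, extraSites N t = if Odd N then 1 else 0 := by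
    rw [Finset.sum_eq_single 0]
    · simp [extraSites]
    · intro t _ ht
      rw [extraSites, if_neg]
      exact fun h => ht (Fin.ext h.1)
    · simp
  rw [Finset.sum_add_distrib, h0]
  rcases Nat.even_or_odd' N with ⟨r, hr | hr⟩
  · have h1 : ⌈(N : ℚ) / 2⌉₊ = r := by
      rw [hr]; push_cast
      rw [mul_div_cancel_left₀ _ two_ne_zero, Nat.ceil_natCast]
    rw [h1, if_neg (by rw [Nat.not_odd_iff_even]; exact ⟨r, by omega⟩)]
    simp [hr]
  · have h1 : ⌈(N : ℚ) / 2⌉₊ = r + 1 := by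
      rw [Nat.ceil_eq_iff (by omega), hr]
      constructor <;> push_cast <;> linarith
    rw [h1, if_pos ⟨r, hr⟩]
    simp
    omega

theorem even_sum_extraSites_add_one (N : ℕ) [NeZero N] : Even (∑ t, (extraSites N t + 1)) := by
  rw [sum_extraSites_add_one]
  exact even_two_mul _

/-- The randomness of the user: families of bit strings with sum zero. -/
abbrev Mask (N F : ℕ) : Type := {r : Fin N → Bits F // ∑ t, r t = 0}

instance (N F : ℕ) : Nonempty (Mask N F) := ⟨⟨0, by simp⟩⟩

/-- The queries, random bit strings whose sum is the indicator of the wanted file. -/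
def maskedQuery {N F : ℕ} [NeZero N] (k : Fin F) (r : Mask N F) : Fin N → Bits F :=
  r.1 + Pi.single 0 (Pi.single k 1)

theorem sum_maskedQuery {N F : ℕ} [NeZero N] (k : Fin F) (r : Mask N F) :
    ∑ t, maskedQuery k r t = Pi.single k 1 := by
  simp only [maskedQuery, Pi.add_apply, Finset.sum_add_distrib, r.2, zero_add]
  simp

/-- A change of the randomness that hides the replacement of the index `k` by `k'` from all servers
other than `t`. -/
def maskShift {N F : ℕ} [NeZero N] (t : Fin N) (k k' : Fin F) : Mask N F ≃ Mask N F where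
  toFun r := ⟨r.1 + (Pi.single 0 (Pi.single k 1 - Pi.single k' 1) -
    Pi.single t (Pi.single k 1 - Pi.single k' 1)), by
      simp [Finset.sum_add_distrib, r.2]⟩
  invFun r := ⟨r.1 - (Pi.single 0 (Pi.single k 1 - Pi.single k' 1) -
    Pi.single t (Pi.single k 1 - Pi.single k' 1)), by
      simp [r.2]⟩
  left_inv r := by ext; simp
  right_inv r := by ext; simp

/-- The index enters the query of server `0` only. The shift corrects it there and restores the sum
zero at server `t`, which alone sees the change; for `t = 0` the shift is trivial. -/
theorem maskedQuery_maskShift {N F : ℕ} [NeZero N] {s t : Fin N} (hs : s ≠ t) (k k' : Fin F)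
    (r : Mask N F) : maskedQuery k' (maskShift t k k' r) s = maskedQuery k r s := by
  simp only [maskedQuery, maskShift, Equiv.coe_fn_mk, Pi.add_apply, Pi.sub_apply,
    Pi.single_eq_of_ne hs]
  by_cases h : s = 0
  · subst h
    simp only [Pi.single_eq_same, sub_zero]
    abel
  · simp [Pi.single_eq_of_ne h]

/-- Files of `2ℓ` bits as pairs of strings of `ℓ` bits. -/
def fileEquiv (ℓ : ℕ) : Fin (2 ^ (2 * ℓ)) ≃ Bits ℓ × Bits ℓ :=
  Fintype.equivOfCardEq (by simp [two_mul, pow_add])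

/-- The sum of the files that are selected by the query. -/
def serverAnswer {F ℓ : ℕ} (q : Bits F) (w : Fin F → Fin (2 ^ (2 * ℓ))) : Bits ℓ × Bits ℓ :=
  ∑ i, q i • fileEquiv ℓ (w i)

theorem sum_serverAnswer {N F ℓ : ℕ} {q : Fin N → Bits F} {k : Fin F}
    (hq : ∑ t, q t = Pi.single k 1) (w : Fin F → Fin (2 ^ (2 * ℓ))) :
    ∑ t, serverAnswer (q t) w = fileEquiv ℓ (w k) := by
  simp only [serverAnswer]
  rw [Finset.sum_comm]
  simp only [← Finset.sum_smul, ← Finset.sum_apply, hq]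
  rw [Finset.sum_eq_single k]
  · simp
  · intro i _ hi
    simp [Pi.single_eq_of_ne hi]
  · simp

/-- The decoder, the measurement of the syndrome. -/
def syndromePOVM (ℓ N : ℕ) [NeZero N] :
    POVM (Option (Fin (2 ^ (2 * ℓ)))) (∀ t, Site ℓ (extraSites N t)) where
  -- Files biject with syndromes, so the outcomes `some w` already exhaust the identity and failure
  -- gets the operator `0`.
  op o := o.elim 0 fun w => syndromeProj (extraSites N) (fileEquiv ℓ w)
  posSemidef o := by
    cases o with
    | none => exact Matrix.PosSemidef.zero
    | some w => exact posSemidef_syndromeProj (even_sum_extraSites_add_one N) _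
  sum_eq_one := by
    rw [Fintype.sum_option]
    simp only [Option.elim, zero_add]
    rw [Equiv.sum_comp (fileEquiv ℓ) fun v => syndromeProj (extraSites N) v, sum_syndromeProj]

/-- The servers apply the Pauli operators of the sums of the selected files to a stabilizer state,
the user measures the syndrome. -/
def stabilizerProtocol (N F ℓ : ℕ) [NeZero N] : QPIRProtocol N F (2 ^ (2 * ℓ)) where
  Prior t := Site ℓ (extraSites N t)
  Sys t := Site ℓ (extraSites N t)
  Query _ := Bits F
  Rand := Mask N F
  priorState := syndromeState (extraSites N) 0
  priorState_isState := isState_syndromeState (even_sum_extraSites_add_one N) 0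
  randLaw := PMF.uniformOfFintype (Mask N F)
  encUser := maskedQuery
  encServ t q w := pauliChannel ℓ (extraSites N t) (serverAnswer q w)
  dec _ _ := syndromePOVM ℓ N

/-! ### Correctness of the decoding. -/

section protocol
variable {N F ℓ : ℕ} [NeZero N]

theorem finalState_stabilizerProtocol {q : Fin N → Bits F} {k : Fin F}
    (hq : ∑ t, q t = Pi.single k 1) (w : Fin F → Fin (2 ^ (2 * ℓ))) :
    (stabilizerProtocol N F ℓ).finalState w q =
      syndromeState (extraSites N) (fileEquiv ℓ (w k)) := by
  rw [← sum_serverAnswer hq w]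
  exact tensorMap_syndromeState fun t => serverAnswer (q t) w

/-- The formula for the final state needs this sum; query tuples outside the support are discarded
by their weight zero. -/
theorem sum_eq_of_queryLaw_ne_zero {q : Fin N → Bits F} {k : Fin F}
    (hq : (stabilizerProtocol N F ℓ).queryLaw k q ≠ 0) : ∑ t, q t = Pi.single k 1 := by
  obtain ⟨r, -, hr⟩ := (PMF.mem_support_map_iff _ _ _).1 ((PMF.mem_support_iff _ _).2 hq)
  rw [← hr]
  exact sum_maskedQuery k r

theorem errorProb_stabilizerProtocol : (stabilizerProtocol N F ℓ).errorProb = 0 := by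
  refine Finset.sum_eq_zero fun w _ => Finset.sum_eq_zero fun k _ => Finset.sum_eq_zero fun q _ => ?_
  by_cases hq : (stabilizerProtocol N F ℓ).queryLaw k q = 0
  · rw [hq]; simp
  · have h : ((stabilizerProtocol N F ℓ).finalState w q *
        ((stabilizerProtocol N F ℓ).dec k q).op (some (w k))).trace = 1 := by
      rw [finalState_stabilizerProtocol (sum_eq_of_queryLaw_ne_zero hq)]
      exact trace_syndromeState_mul (even_sum_extraSites_add_one N) _
    rw [h]; simp

/-! ### Server secrecy, from the independence of distinct files. -/

theorem average_mul_of_ne {M : ℕ} {i k : Fin F} (hik : i ≠ k) (f g : Fin M → ℂ) :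
    ∑ w : Fin F → Fin M, ((M : ℂ) ^ F)⁻¹ * (f (w i) * g (w k)) =
      ((M : ℂ)⁻¹ * ∑ u, f u) * ((M : ℂ)⁻¹ * ∑ u, g u) := by
  rcases Nat.eq_zero_or_pos M with rfl | hM
  · have : IsEmpty (Fin F → Fin 0) := ⟨fun w => (w i).elim0⟩
    simp
  have hM' : (M : ℂ) ≠ 0 := by exact_mod_cast hM.ne'
  -- With `f` at `i`, `g` at `k` and `1` elsewhere, the summand becomes a product over all files,
  -- whose average factorises.
  let h : Fin F → Fin M → ℂ := Function.update (Function.update (fun _ _ => 1) k g) i f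
  have hi : h i = f := by simp [h]
  have hk : h k = g := by simp [h, hik.symm]
  have ho : ∀ j, j ≠ i ∧ j ≠ k → h j = fun _ => 1 := fun j hj => by simp [h, hj.1, hj.2]
  have h1 : ∀ w : Fin F → Fin M, f (w i) * g (w k) = ∏ j, h j (w j) := fun w => by
    rw [Finset.prod_eq_mul i k hik (fun j _ hj => by rw [ho j hj]) (by simp) (by simp), hi, hk]
  have h2 : ∏ j, ((M : ℂ)⁻¹ * ∑ u, h j u) =
      ((M : ℂ)⁻¹ * ∑ u, f u) * ((M : ℂ)⁻¹ * ∑ u, g u) := by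
    rw [Finset.prod_eq_mul i k hik (fun j _ hj => by rw [ho j hj]; simp [hM']) (by simp) (by simp),
      hi, hk]
  simp only [h1, ← Finset.mul_sum]
  rw [← h2, Finset.prod_mul_distrib, Finset.prod_univ_sum]
  simp

theorem sum_single_kronecker_of_ne {M : ℕ} [NeZero M] {S : Type} [Fintype S] [DecidableEq S]
    {i k : Fin F} (hik : i ≠ k) (σ : Fin M → Matrix S S ℂ)
    (hσ : ∑ u, σ u = ((M : ℂ) / Fintype.card S) • 1) :
    ∑ w : Fin F → Fin M, ((M : ℂ) ^ F)⁻¹ • (Matrix.single (w i) (w i) (1 : ℂ) ⊗ₖ σ (w k)) =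
      (Fintype.card (Fin M × S) : ℂ)⁻¹ • 1 := by
  have hM : (M : ℂ) ≠ 0 := by simp [NeZero.ne M]
  ext ⟨a, x⟩ ⟨b, y⟩
  simp only [Matrix.sum_apply, Matrix.smul_apply, Matrix.kroneckerMap_apply, smul_eq_mul]
  rw [average_mul_of_ne hik (fun u => Matrix.single u u (1 : ℂ) a b) fun u => σ u x y,
    ← Matrix.sum_apply, ← Matrix.sum_apply, hσ, Matrix.sum_single_one, ← Matrix.one_kronecker_one,
    Matrix.kroneckerMap_apply, Matrix.smul_apply, smul_eq_mul, Fintype.card_prod, Fintype.card_fin]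
  push_cast
  rw [mul_inv]
  field_simp

/-- The state received by the user who retrieves the file `u`. -/
def retrievalState (N F ℓ : ℕ) [NeZero N] (u : Fin (2 ^ (2 * ℓ))) :
    Matrix (∀ t, (stabilizerProtocol N F ℓ).Sys t) (∀ t, (stabilizerProtocol N F ℓ).Sys t) ℂ :=
  syndromeState (extraSites N) (fileEquiv ℓ u)

theorem sum_retrievalState :
    ∑ u, retrievalState N F ℓ u =
      (((2 ^ (2 * ℓ) : ℕ) : ℂ) / Fintype.card (∀ t, (stabilizerProtocol N F ℓ).Sys t)) • 1 := by
  have hsum := sum_syndromeState (ℓ := ℓ) (m := extraSites N)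
  rw [← Equiv.sum_comp (fileEquiv ℓ), ← Fintype.card_congr (fileEquiv ℓ), Fintype.card_fin] at hsum
  exact hsum

instance : Nonempty (∀ t, (stabilizerProtocol N F ℓ).Sys t) :=
  inferInstanceAs (Nonempty (∀ t, Site ℓ (extraSites N t)))

theorem fileStateOfQuery_stabilizerProtocol {q : ∀ t, (stabilizerProtocol N F ℓ).Query t}
    {i k : Fin F} (hik : i ≠ k) (hq : (stabilizerProtocol N F ℓ).queryLaw k q ≠ 0) :
    (stabilizerProtocol N F ℓ).fileStateOfQuery i q =
      (Fintype.card (Fin (2 ^ (2 * ℓ)) × ∀ t, (stabilizerProtocol N F ℓ).Sys t) : ℂ)⁻¹ • 1 := by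
  rw [← sum_single_kronecker_of_ne hik _ sum_retrievalState]
  refine Finset.sum_congr rfl fun w _ => ?_
  rw [finalState_stabilizerProtocol (sum_eq_of_queryLaw_ne_zero hq), retrievalState]

/-- Every query tuple of positive probability gives the same state, so mixing over queries changes
nothing. -/
theorem fileState_stabilizerProtocol {i k : Fin F} (hik : i ≠ k) :
    (stabilizerProtocol N F ℓ).fileState i k =
      (Fintype.card (Fin (2 ^ (2 * ℓ)) × ∀ t, (stabilizerProtocol N F ℓ).Sys t) : ℂ)⁻¹ • 1 := by
  have h : ∀ q : ∀ t, (stabilizerProtocol N F ℓ).Query t,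
      (((stabilizerProtocol N F ℓ).queryLaw k q).toReal : ℂ) •
        (stabilizerProtocol N F ℓ).fileStateOfQuery i q =
      (((stabilizerProtocol N F ℓ).queryLaw k q).toReal : ℂ) •
        ((Fintype.card (Fin (2 ^ (2 * ℓ)) × ∀ t, (stabilizerProtocol N F ℓ).Sys t) : ℂ)⁻¹ • 1) := by
    intro q
    by_cases hq : (stabilizerProtocol N F ℓ).queryLaw k q = 0
    · rw [hq]; simp
    · rw [fileStateOfQuery_stabilizerProtocol hik hq]
  rw [QPIRProtocol.fileState, Finset.sum_congr rfl fun q _ => h q, ← Finset.sum_smul,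
    ← Complex.ofReal_sum, sum_toReal_pmf, Complex.ofReal_one, one_smul]

theorem serverLeakage_stabilizerProtocol : (stabilizerProtocol N F ℓ).serverLeakage = 0 := by
  have h : ∀ p : {p : Fin F × Fin F // p.1 ≠ p.2},
      quantumMutualInfo ((stabilizerProtocol N F ℓ).fileState p.1.1 p.1.2) = 0 := fun p => by
    rw [fileState_stabilizerProtocol p.2]
    exact quantumMutualInfo_smul_one
  simp only [QPIRProtocol.serverLeakage, h, Real.iSup_const_zero]

theorem serverLeakageGivenQueries_stabilizerProtocol :
    (stabilizerProtocol N F ℓ).serverLeakageGivenQueries = 0 := by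
  have h : ∀ (p : {p : Fin F × Fin F // p.1 ≠ p.2})
      (q : ∀ t, (stabilizerProtocol N F ℓ).Query t),
      ((stabilizerProtocol N F ℓ).queryLaw p.1.2 q).toReal *
        quantumMutualInfo ((stabilizerProtocol N F ℓ).fileStateOfQuery p.1.1 q) = 0 := by
    intro p q
    by_cases hq : (stabilizerProtocol N F ℓ).queryLaw p.1.2 q = 0
    · rw [hq]; simp
    · rw [fileStateOfQuery_stabilizerProtocol p.2 hq]
      exact mul_eq_zero_of_right _ quantumMutualInfo_smul_one
  simp only [QPIRProtocol.serverLeakageGivenQueries, h, Finset.sum_const_zero,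
    Real.iSup_const_zero]

/-! ### User secrecy. -/

theorem otherQueryLaw_stabilizerProtocol (t : Fin N) (k k' : Fin F) :
    (stabilizerProtocol N F ℓ).otherQueryLaw t k = (stabilizerProtocol N F ℓ).otherQueryLaw t k' := by
  -- Away from `t`, changing `k` to `k'` amounts to a bijection of the masks, which preserves their
  -- uniform law.
  have h : (fun (q : Fin N → Bits F) (s : {s : Fin N // s ≠ t}) => q s) ∘ maskedQuery k =
      ((fun (q : Fin N → Bits F) (s : {s : Fin N // s ≠ t}) => q s) ∘ maskedQuery k') ∘
        maskShift t k k' := by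
    funext r s
    exact (maskedQuery_maskShift s.2 k k' r).symm
  have h1 : ∀ j : Fin F, (stabilizerProtocol N F ℓ).otherQueryLaw t j =
      (PMF.uniformOfFintype (Mask N F)).map
        ((fun (q : Fin N → Bits F) (s : {s : Fin N // s ≠ t}) => q s) ∘ maskedQuery j) :=
    fun j => PMF.map_comp _ _ _
  rw [h1, h1, h, ← PMF.map_comp, map_equiv_uniformOfFintype]

theorem userLeakage_stabilizerProtocol [NeZero F] :
    (stabilizerProtocol N F ℓ).userLeakage = 0 := by
  have h : ∀ t : Fin N, mutualInfo (fun (k : Fin F) q' =>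
      (F : ℝ)⁻¹ * ((stabilizerProtocol N F ℓ).otherQueryLaw t k q').toReal) = 0 := fun t => by
    have h1 : ∀ k, (stabilizerProtocol N F ℓ).otherQueryLaw t k =
        (stabilizerProtocol N F ℓ).otherQueryLaw t 0 :=
      fun k => otherQueryLaw_stabilizerProtocol t k 0
    simp only [h1]
    refine mutualInfo_mul _ _ ?_ (sum_toReal_pmf _)
    simp [NeZero.ne F]
  simp only [QPIRProtocol.userLeakage, h, Real.iSup_const_zero]

/-! ### Download cost, rate and upload cost. -/

theorem download_stabilizerProtocol :
    (stabilizerProtocol N F ℓ).download = 2 ^ (2 * ℓ * ⌈(N : ℚ) / 2⌉₊) := by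
  have h : ∀ t, Fintype.card (Site ℓ (extraSites N t)) = (2 ^ ℓ) ^ (extraSites N t + 1) := by
    intro t
    simp [pow_succ, mul_comm]
  refine (Finset.prod_congr rfl fun t _ => h t).trans ?_
  rw [Finset.prod_pow_eq_pow_sum, sum_extraSites_add_one, ← pow_mul]
  ring_nf

theorem rate_stabilizerProtocol (hℓ : ℓ ≠ 0) :
    (stabilizerProtocol N F ℓ).rate = ((⌈(N : ℚ) / 2⌉₊ : ℕ) : ℝ)⁻¹ := by
  rw [QPIRProtocol.rate, download_stabilizerProtocol]
  rw [Nat.cast_pow, Nat.cast_pow, Real.log_pow, Real.log_pow, Nat.cast_ofNat]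
  have h1 : Real.log 2 ≠ 0 := (Real.log_pos one_lt_two).ne'
  have h2 : (ℓ : ℝ) ≠ 0 := by exact_mod_cast hℓ
  have h3 : (((2 * ℓ : ℕ) : ℝ) * Real.log 2) ≠ 0 := by
    push_cast; positivity
  rw [Nat.cast_mul (2 * ℓ), mul_right_comm, div_mul_cancel_left₀ h3]

theorem upload_stabilizerProtocol : (stabilizerProtocol N F ℓ).upload = 2 ^ (N * F) := by
  have h : ∀ t : Fin N, Fintype.card ((stabilizerProtocol N F ℓ).Query t) = 2 ^ F := fun t => by
    change Fintype.card (Bits F) = _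
    simp
  rw [QPIRProtocol.upload, Finset.prod_congr rfl fun t _ => h t]
  simp [← pow_mul, mul_comm]

end protocol

end QPIR

end

theorem theorem1 (N F ℓ : ℕ) (hN : 2 ≤ N) (hF : 2 ≤ F) (hℓ : 1 ≤ ℓ) :
    ∃ Ψ : QPIR.QPIRProtocol N F (2 ^ (2 * ℓ)),
      Ψ.IsPrivateSymmetric ∧
      Ψ.serverLeakageGivenQueries = 0 ∧
      Ψ.rate = ((⌈(N : ℚ) / 2⌉₊ : ℕ) : ℝ)⁻¹ ∧
      Ψ.upload = 2 ^ (N * F) := by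
  have : NeZero N := ⟨by omega⟩
  have : NeZero F := ⟨by omega⟩
  exact ⟨QPIR.stabilizerProtocol N F ℓ, ⟨QPIR.errorProb_stabilizerProtocol,
    QPIR.serverLeakage_stabilizerProtocol, QPIR.userLeakage_stabilizerProtocol⟩,
    QPIR.serverLeakageGivenQueries_stabilizerProtocol,
    QPIR.rate_stabilizerProtocol (by omega), QPIR.upload_stabilizerProtocol⟩
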